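/- Let $\Phi$ be an irreducible, reduced, crystallographic (finite) root system in a real vector space ${\bf E}$ (the root system of a simple finite-dimensional complex Lie algebra), with simple roots $\alpha_1,\dots,\alpha_R$, simple reflections $\sigma_1,\dots,\sigma_R$ and fundamental weights $\Lambda_1,\dots,\Lambda_R$. Let $(\cdot,\cdot)$ be the Weyl group invariant inner product normalised by $(\alpha,\alpha)=2$ for short roots $\alpha$; it is integral on the root lattice. Let $q\in\mathbb C\setminus\{0\}$ not be a root of unity. Let $\omega^{\mathfrak r}=\sigma_{i_1}\sigma_{i_2}\cdots\sigma_{i_r}$ be a reduced expression of a Weyl group element, and put $\beta_j=\sigma_{i_1}\cdots\sigma_{i_{j-1}}(\alpha_{i_j})$ for $1\le j\le r$. Let $\overline{\mathcal L}_q({\mathfrak r})$ be the $\mathbb C$-algebra generated by invertible elements $z_1^{\pm1},\dots,z_r^{\pm1}$ with relations $z_iz_j=q^{(\beta_i,\beta_j)}z_jz_i$ for $i<j$. Let $I=\{i_1,\dots,i_r\}\subseteq\{1,\dots,R\}$. For $s\in I$ let $\overline C_s=z_{j_1}z_{j_2}\cdots z_{j_m}$, where $j_1<\dots<j_m$ are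 the positions $j$ with $i_j=s$; put $\overline C_s=1$ for $s\notin I$. Let $S_{\mathfrak r}=\mathrm{Span}_{\mathbb R}\{\alpha_s\mid s\in I\}$, which is invariant under $\omega^{\mathfrak r}$, and let $\overline\Lambda_s$ denote the restriction of $\Lambda_s$ to $S_{\mathfrak r}$, that is, its orthogonal projection onto $S_{\mathfrak r}$. Theorem. The center of $\overline{\mathcal L}_q({\mathfrak r})$ is given by the kernel of $1+\omega^{\mathfrak r}$ on $S_{\mathfrak r}$, in the following sense. Fix any order of the simple roots, and for integers $(n_s)_{s=1}^R$ with $n_s=0$ for $s\notin I$ let $\overline C^{\,n}=\prod_s\overline C_s^{\,n_s}$, the factors taken in this order. Then: 1. $\overline C^{\,n}$ is central in $\overline{\mathcal L}_q({\mathfrak r})$ if and only if $(1+\omega^{\mathfrak r})\bigl(\sum_s n_s\overline\Lambda_s\bigr)=0$. 2. The monomials $\overline C^{\,n}$ are linearly independent over $\mathbb C$, and the center of $\overline{\mathcal L}_q({\mathfrak r})$ is the $\mathbb C$-linear span of those $\overline C^{\,n}$ for which $(1+\omega^{\mathfrak r})\bigl(\sum_s n_s\overline\Lambda_s\bigr)=0$.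 -/

import Mathlib

noncomputable section

namespace QuantumTorusCenter

/-! ### Quasi-Laurent algebras (quantum tori), by generators and relations -/

/-- The defining relations of the quasi-Laurent algebra: `Sum.inl j` is the generator `z_j` and
`Sum.inr j` is its inverse. -/
inductive QuasiLaurentRel {r : ℕ} (q : ℂ) (L : Fin r → Fin r → ℤ) :
    FreeAlgebra ℂ (Fin r ⊕ Fin r) → FreeAlgebra ℂ (Fin r ⊕ Fin r) → Prop
  | mul_inv (j : Fin r) :
      QuasiLaurentRel q L (FreeAlgebra.ι ℂ (Sum.inl j) * FreeAlgebra.ι ℂ (Sum.inr j)) 1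
  | inv_mul (j : Fin r) :
      QuasiLaurentRel q L (FreeAlgebra.ι ℂ (Sum.inr j) * FreeAlgebra.ι ℂ (Sum.inl j)) 1
  | comm (i j : Fin r) (hij : i < j) :
      QuasiLaurentRel q L (FreeAlgebra.ι ℂ (Sum.inl i) * FreeAlgebra.ι ℂ (Sum.inl j))
        (q ^ L i j • (FreeAlgebra.ι ℂ (Sum.inl j) * FreeAlgebra.ι ℂ (Sum.inl i)))

/-- The `ℂ`-algebra generated by invertible elements `z_1, …, z_r` with the relations
`z_i z_j = q ^ (L i j) z_j z_i` for `i < j`. -/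
def QuasiLaurent {r : ℕ} (q : ℂ) (L : Fin r → Fin r → ℤ) : Type :=
  RingQuot (QuasiLaurentRel q L)

instance {r : ℕ} (q : ℂ) (L : Fin r → Fin r → ℤ) : Ring (QuasiLaurent q L) :=
  inferInstanceAs (Ring (RingQuot (QuasiLaurentRel q L)))

instance {r : ℕ} (q : ℂ) (L : Fin r → Fin r → ℤ) : Algebra ℂ (QuasiLaurent q L) :=
  inferInstanceAs (Algebra ℂ (RingQuot (QuasiLaurentRel q L)))

/-- The quotient map onto the quasi-Laurent algebra. -/
def QuasiLaurent.mk {r : ℕ} (q : ℂ) (L : Fin r → Fin r → ℤ) :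
    FreeAlgebra ℂ (Fin r ⊕ Fin r) →ₐ[ℂ] QuasiLaurent q L :=
  RingQuot.mkAlgHom ℂ (QuasiLaurentRel q L)

theorem QuasiLaurent.mk_rel {r : ℕ} (q : ℂ) (L : Fin r → Fin r → ℤ)
    {x y : FreeAlgebra ℂ (Fin r ⊕ Fin r)} (h : QuasiLaurentRel q L x y) :
    QuasiLaurent.mk q L x = QuasiLaurent.mk q L y :=
  RingQuot.mkAlgHom_rel ℂ h

/-- The invertible generator `z_j`. -/
def QuasiLaurent.z {r : ℕ} (q : ℂ) (L : Fin r → Fin r → ℤ) (j : Fin r) : (QuasiLaurent q L)ˣ where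
  val := QuasiLaurent.mk q L (FreeAlgebra.ι ℂ (Sum.inl j))
  inv := QuasiLaurent.mk q L (FreeAlgebra.ι ℂ (Sum.inr j))
  val_inv := by
    rw [← map_mul, QuasiLaurent.mk_rel q L (QuasiLaurentRel.mul_inv j), map_one]
  inv_val := by
    rw [← map_mul, QuasiLaurent.mk_rel q L (QuasiLaurentRel.inv_mul j), map_one]

/-! ### The invariant form -/

section RootSystem

variable {ι V N : Type*} [Fintype ι] [AddCommGroup V] [Module ℝ V] [AddCommGroup N] [Module ℝ N]

/-- The Weyl group invariant symmetric bilinear form `( , )`, normalised so that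
`(α, α) = 2` for the short roots `α`. -/
def normForm (P : RootPairing ι ℝ V N) : LinearMap.BilinForm ℝ V :=
  (2 / ⨅ i, P.RootForm (P.root i) (P.root i)) • P.RootForm

theorem normForm_apply (P : RootPairing ι ℝ V N) (x y : V) :
    normForm P x y = 2 / (⨅ i, P.RootForm (P.root i) (P.root i)) * P.RootForm x y := rfl

theorem exists_short (P : RootPairing ι ℝ V N) [Nonempty ι] :
    ∃ i, P.RootForm (P.root i) (P.root i) = (⨅ j, P.RootForm (P.root j) (P.root j)) ∧
      ∀ j, P.RootForm (P.root i) (P.root i) ≤ P.RootForm (P.root j) (P.root j) := by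
  obtain ⟨i, hi⟩ := Finite.exists_min fun j => P.RootForm (P.root j) (P.root j)
  exact ⟨i, le_antisymm (le_ciInf hi) (ciInf_le (Set.finite_range _).bddBelow i), hi⟩

theorem rootForm_root_pos (P : RootPairing ι ℝ V N) (i : ι) :
    0 < P.RootForm (P.root i) (P.root i) :=
  P.rootForm_pos_of_ne_zero (Submodule.subset_span ⟨i, rfl⟩) (P.ne_zero i)

/-- The normalised form takes the value `2` on short roots, and at least `2` on all roots. -/
theorem normForm_short (P : RootPairing ι ℝ V N) [Nonempty ι] :
    (∃ i, normForm P (P.root i) (P.root i) = 2) ∧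
      ∀ j, 2 ≤ normForm P (P.root j) (P.root j) := by
  obtain ⟨i, hi, hmin⟩ := exists_short P
  have hpos := rootForm_root_pos P i
  refine ⟨⟨i, ?_⟩, fun j => ?_⟩
  · rw [normForm_apply, ← hi]
    field_simp
  · rw [normForm_apply, ← hi, div_mul_eq_mul_div, le_div_iff₀ hpos]
    linarith [hmin j]

/-- The normalised form is integral on pairs of roots. -/
theorem normForm_root_root_integral (P : RootPairing ι ℝ V N) [P.IsCrystallographic]
    [P.IsReduced] [P.IsIrreducible] (i j : ι) :
    ∃ m : ℤ, (m : ℝ) = normForm P (P.root i) (P.root j) := by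
  have : Nonempty ι := ⟨i⟩
  obtain ⟨k, hk, hmin⟩ := exists_short P
  have hpos := rootForm_root_pos P k
  have h2 : 2 * P.RootForm (P.root i) (P.root j) =
      (P.pairingIn ℤ i j : ℝ) * P.RootForm (P.root j) (P.root j) := by
    have h := P.toInvariantForm.two_mul_apply_root_root i j
    rw [← P.algebraMap_pairingIn ℤ i j] at h
    simpa using h
  have h3 : ∃ c : ℤ, P.RootForm (P.root j) (P.root j) =
      c * P.RootForm (P.root k) (P.root k) := by
    have hjk := hmin j
    rcases P.toInvariantForm.apply_eq_or j k with h | h | h | h | h <;>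
      simp only [RootPairing.toInvariantForm_form] at h
    · exact ⟨1, by simpa using h⟩
    · exact ⟨2, by simpa using h⟩
    · exact ⟨3, by simpa using h⟩
    · linarith
    · linarith
  obtain ⟨c, hc⟩ := h3
  refine ⟨P.pairingIn ℤ i j * c, ?_⟩
  rw [normForm_apply, ← hk, div_mul_eq_mul_div, h2, hc]
  push_cast
  field_simp

/-! ### Words in the simple reflections -/

variable {P : RootPairing ι ℝ V N} (b : P.Base)

/-- The Weyl group element `σ_{i_1} σ_{i_2} ⋯ σ_{i_r}` of a word in the simple roots. -/
def weylElt (w : List b.support) : V ≃ₗ[ℝ] V :=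
  (w.map fun s => P.reflection (s : ι)).prod

/-- The word is reduced: no shorter word represents the same Weyl group element. -/
def IsReducedWord (w : List b.support) : Prop :=
  ∀ w' : List b.support, weylElt b w' = weylElt b w → w.length ≤ w'.length

/-- The root `β_j = σ_{i_1} ⋯ σ_{i_{j-1}} (α_{i_j})` (positions are counted from `0` in the code). -/
def beta (w : List b.support) (j : Fin w.length) : V :=
  weylElt b (w.take j) (P.root (w.get j))

/-- The integer `(β_i, β_j)`; see `commExponent_eq`. -/
def commExponent (w : List b.support) (i j : Fin w.length) : ℤ :=
  ⌊normForm P (beta b w i) (beta b w j)⌋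

set_option linter.unusedSectionVars false in
theorem exists_root_eq_weylElt (w : List b.support) (i : ι) :
    ∃ k, P.root k = weylElt b w (P.root i) := by
  induction w with
  | nil => exact ⟨i, rfl⟩
  | cons s w ih =>
    obtain ⟨k, hk⟩ := ih
    refine ⟨P.reflectionPerm (s : ι) k, ?_⟩
    rw [P.root_reflectionPerm, hk]
    simp [weylElt]

/-- The integer `commExponent b w i j` is indeed `(β_i, β_j)`. -/
theorem commExponent_eq [P.IsCrystallographic] [P.IsReduced] [P.IsIrreducible]
    (w : List b.support) (i j : Fin w.length) :
    (commExponent b w i j : ℝ) = normForm P (beta b w i) (beta b w j) := by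
  obtain ⟨k, hk⟩ := exists_root_eq_weylElt b (w.take i) (w.get i)
  obtain ⟨l, hl⟩ := exists_root_eq_weylElt b (w.take j) (w.get j)
  obtain ⟨m, hm⟩ := normForm_root_root_integral P k l
  unfold commExponent beta
  rw [← hk, ← hl, ← hm, Int.floor_intCast]

/-- The fundamental weight `Λ_s`, the dual basis vector of the simple coroots. -/
def fundWeight [P.IsRootSystem] (s : b.support) : V :=
  P.toPerfPair.symm (b.toCoweightBasis.coord s)

open scoped Classical in
/-- `⟨Λ_s, α_t^∨⟩ = δ_{s,t}`. -/
theorem fundWeight_coroot [P.IsRootSystem] (s t : b.support) :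
    P.toLinearMap (fundWeight b s) (P.coroot (t : ι)) = if t = s then 1 else 0 := by
  have h : P.toLinearMap (fundWeight b s) = b.toCoweightBasis.coord s :=
    P.toPerfPair.apply_symm_apply (b.toCoweightBasis.coord s)
  rw [h, Module.Basis.coord_apply, RootPairing.Base.toCoweightBasis_repr_coroot,
    Finsupp.single_apply]

/-- The space `S_𝔯` spanned by the simple roots that occur in the word. -/
def wordSpan (w : List b.support) : Submodule ℝ V :=
  Submodule.span ℝ {x | ∃ s ∈ w, x = P.root (s : ι)}

theorem isCompl_wordSpan [P.IsRootSystem] (w : List b.support) :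
    IsCompl (wordSpan b w) ((normForm P).orthogonal (wordSpan b w)) := by
  have : FiniteDimensional ℝ V := Module.Finite.of_basis b.toWeightBasis
  have hsymm : ∀ x y, normForm P x y = normForm P y x := fun x y => by
    rw [normForm_apply, normForm_apply, P.rootForm_symmetric.eq x y |>.symm]
    simp
  rw [LinearMap.BilinForm.isCompl_orthogonal_iff_disjoint fun x y h => by rw [hsymm, h]]
  rw [Submodule.disjoint_def]
  intro x hx hx'
  have h0 : normForm P x x = 0 := hx' x hx
  by_contra hne
  have hpos : 0 < P.RootForm x x := P.rootForm_pos_of_ne_zero (by simp) hne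
  cases isEmpty_or_nonempty ι with
  | inl h =>
    rw [P.rootForm_apply_apply] at hpos
    simp at hpos
  | inr h =>
    obtain ⟨i, hi, -⟩ := exists_short P
    have hi' := rootForm_root_pos P i
    rw [normForm_apply, ← hi] at h0
    have : 0 < 2 / P.RootForm (P.root i) (P.root i) * P.RootForm x x := by positivity
    linarith

/-- Restriction of weights to `S_𝔯`: the orthogonal projection onto `S_𝔯`. -/
def restrictWeight [P.IsRootSystem] (w : List b.support) : V →ₗ[ℝ] V :=
  Submodule.projection _ _ (isCompl_wordSpan b w)

/-- The kernel of `1 + ω` on `S_𝔯`. -/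
def kerOnePlus (w : List b.support) : Submodule ℝ V :=
  wordSpan b w ⊓ LinearMap.ker (LinearMap.id + (weylElt b w).toLinearMap)

/-! ### The elements `C_s` and their monomials -/

/-- The quasi-Laurent algebra attached to a word: `z_i z_j = q ^ (β_i, β_j) z_j z_i` for `i < j`. -/
abbrev WordAlgebra (q : ℂ) (w : List b.support) : Type :=
  QuasiLaurent q (commExponent b w)

open scoped Classical in
/-- `C_s`: the product, in increasing order, of the `z_j` over the positions `j` at which `α_s`
occurs in the word (so `C_s = 1` if `α_s` does not occur). -/
def covariant (q : ℂ) (w : List b.support) (s : b.support) : (WordAlgebra b q w)ˣ :=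
  (((List.finRange w.length).filter fun j => w.get j = s).map
    (QuasiLaurent.z q (commExponent b w))).prod

/-- The monomial `∏ C_s ^ n_s`, the factors taken in the order of the numbering `e` of the simple
roots. -/
def covariantMonomial {R : ℕ} (e : Fin R ≃ b.support) (q : ℂ) (w : List b.support)
    (n : b.support → ℤ) : (WordAlgebra b q w)ˣ :=
  (List.ofFn fun k => covariant b q w (e k) ^ n (e k)).prod

/-- Integer exponent vectors `(n_s)` with `n_s = 0` whenever `α_s` does not occur in the word. -/
def Exponents (w : List b.support) : Set (b.support → ℤ) :=
  {n | ∀ s, s ∉ w → n s = 0}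

/-- The weight `∑ n_s Λ_s`, restricted to `S_𝔯`. -/
def restrictedWeight [P.IsRootSystem] (w : List b.support) (n : b.support → ℤ) : V :=
  restrictWeight b w (∑ s, n s • fundWeight b s)

end RootSystem
end QuantumTorusCenter
end

/-! A Laurent monomial of degree `a` commutes with `z_j` up to `q ^ ∑ i, a i * skew L i j`
(`HasDegree.mul_z`). Monomials of equal degree are proportional, monomials of distinct degrees are
linearly independent, and together they span. Since `q` is not a root of unity, the center is
therefore spanned by the monomials whose degree lies in the kernel of the matrix `skew`
(`center_eq_span`).

For a word, put `T = ∑ a_i β_i` and let `P_j` be its part over the positions before `j`. Up to sign,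
the `j`-th kernel equation says that `T - 2 P_j - a_j β_j` is orthogonal to `β_j`. If the earlier
equations hold, `T - 2 P_j` is the image of `T` under the prefix of the word before `j`, so by
invariance of the form the equation becomes `⟨T, α_{i_j}^∨⟩ = 2 a_j` (`sum_mul_skew_eq_zero_iff`).

Hence `a_j` depends only on the letter `i_j`, which makes the monomial proportional to some `C^n`,
and `T` is twice the restricted weight `μ` of `n`. Running through the whole word gives `T - 2T =
ωT`, that is `ωμ = -μ`. Conversely, the telescoping identity `∑ n_{i_j} β_j = μ - ωμ` turns `ωμ =
-μ` into `T = 2μ`, which is the system of equations above. -/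

noncomputable section

namespace QuantumTorusCenter
namespace QuasiLaurent

/-! ### Monomials in a quantum torus and their commutation factors -/

variable {r : ℕ} {q : ℂ} {L : Fin r → Fin r → ℤ}

/-- The antisymmetric matrix of commutation exponents: `z_i z_j = q ^ skew L i j z_j z_i` for all
`i`, `j`. -/
def skew (L : Fin r → Fin r → ℤ) (i j : Fin r) : ℤ :=
  if i < j then L i j else if j < i then -L j i else 0

theorem z_mul_z (hq0 : q ≠ 0) (i j : Fin r) :
    (z q L i : QuasiLaurent q L) * z q L j =
      q ^ skew L i j • ((z q L j : QuasiLaurent q L) * z q L i) := by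
  have key : ∀ i j : Fin r, i < j → (z q L i : QuasiLaurent q L) * z q L j =
      q ^ L i j • ((z q L j : QuasiLaurent q L) * z q L i) := fun i j hij => by
    have h := mk_rel q L (QuasiLaurentRel.comm i j hij)
    simp only [map_mul, map_smul] at h
    exact h
  rcases lt_trichotomy i j with h | rfl | h
  · rw [skew, if_pos h, key i j h]
  · simp [skew]
  · rw [skew, if_neg h.not_gt, if_pos h, key j i h, smul_smul, ← zpow_add₀ hq0]
    simp

/-- `HasDegree x a`: the unit `x` is a product of the generators and their inverses, with
exponents adding up to `a`. -/
inductive HasDegree (q : ℂ) (L : Fin r → Fin r → ℤ) : (QuasiLaurent q L)ˣ → (Fin r → ℤ) → Prop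
  | one : HasDegree q L 1 0
  | z (j : Fin r) : HasDegree q L (z q L j) (Pi.single j 1)
  | mul {x y : (QuasiLaurent q L)ˣ} {a b : Fin r → ℤ} :
      HasDegree q L x a → HasDegree q L y b → HasDegree q L (x * y) (a + b)
  | inv {x : (QuasiLaurent q L)ˣ} {a : Fin r → ℤ} : HasDegree q L x a → HasDegree q L x⁻¹ (-a)

namespace HasDegree

theorem pow {x : (QuasiLaurent q L)ˣ} {a : Fin r → ℤ} (h : HasDegree q L x a) (n : ℕ) :
    HasDegree q L (x ^ n) (n • a) := by
  induction n with
  | zero => simpa using HasDegree.one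
  | succ n ih =>
    rw [pow_succ, succ_nsmul]
    exact ih.mul h

theorem zpow {x : (QuasiLaurent q L)ˣ} {a : Fin r → ℤ} (h : HasDegree q L x a) (n : ℤ) :
    HasDegree q L (x ^ n) (n • a) := by
  cases n with
  | ofNat n => simpa using h.pow n
  | negSucc n =>
    rw [zpow_negSucc, negSucc_zsmul]
    exact (h.pow (n + 1)).inv

theorem list_prod {β : Type*} (l : List β) (x : β → (QuasiLaurent q L)ˣ) (a : β → Fin r → ℤ)
    (h : ∀ k ∈ l, HasDegree q L (x k) (a k)) : HasDegree q L (l.map x).prod (l.map a).sum := by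
  induction l with
  | nil => exact HasDegree.one
  | cons k l ih =>
    simp only [List.map_cons, List.prod_cons, List.sum_cons]
    exact (h k (by simp)).mul (ih fun k hk => h k (by simp [hk]))

theorem exists_unit (a : Fin r → ℤ) : ∃ x, HasDegree q L x a := by
  have h := list_prod (q := q) (L := L) (List.finRange r) (fun j => QuasiLaurent.z q L j ^ a j)
    (fun j => a j • Pi.single j (1 : ℤ)) fun j _ => (HasDegree.z j).zpow (a j)
  refine ⟨_, Eq.mp (congrArg _ ?_) h⟩
  rw [← List.ofFn_eq_map, List.sum_ofFn]
  ext k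
  simp [Finset.sum_apply, Pi.single_apply]

/-- The factor picked up in passing `z_j` is multiplicative in the monomial, so its exponent is
additive in the degree. -/
theorem mul_z (hq0 : q ≠ 0) {x : (QuasiLaurent q L)ˣ} {a : Fin r → ℤ} (h : HasDegree q L x a)
    (j : Fin r) : (x : QuasiLaurent q L) * QuasiLaurent.z q L j =
      q ^ (∑ i, a i * skew L i j) • ((QuasiLaurent.z q L j : QuasiLaurent q L) * x) := by
  induction h with
  | one => simp
  | z i =>
    rw [z_mul_z hq0]
    simp [Pi.single_apply]
  | mul _ _ ihx ihy =>
    simp only [Units.val_mul, Pi.add_apply, add_mul, Finset.sum_add_distrib]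
    rw [mul_assoc, ihy, mul_smul_comm, ← mul_assoc, ihx, smul_mul_assoc, smul_smul, mul_assoc,
      zpow_add₀ hq0, mul_comm (q ^ _)]
  | @inv x a _ ih =>
    simp only [Pi.neg_apply, neg_mul, Finset.sum_neg_distrib, zpow_neg]
    rw [Units.inv_mul_eq_iff_eq_mul, mul_smul_comm, ← mul_assoc, ih, smul_mul_assoc, smul_smul,
      inv_mul_cancel₀ (zpow_ne_zero _ hq0), one_smul, Units.mul_inv_cancel_right]

end HasDegree

/-! ### Units of the same degree are proportional -/

/-- The subgroup of scalar units. -/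
def scalars (q : ℂ) (L : Fin r → Fin r → ℤ) : Subgroup (QuasiLaurent q L)ˣ :=
  (Units.map (algebraMap ℂ (QuasiLaurent q L)).toMonoidHom).range

theorem mem_scalars {x : (QuasiLaurent q L)ˣ} :
    x ∈ scalars q L ↔ ∃ c : ℂˣ, (x : QuasiLaurent q L) = algebraMap ℂ _ (c : ℂ) := by
  simp [scalars, MonoidHom.mem_range, Units.ext_iff, eq_comm]

instance : (scalars q L).Normal where
  conj_mem x hx g := by
    obtain ⟨c, hc⟩ := mem_scalars.1 hx
    have : g * x * g⁻¹ = x := by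
      rw [mul_inv_eq_iff_eq_mul]
      ext
      rw [Units.val_mul, Units.val_mul, hc, Algebra.commutes]
    rwa [this]

/-- The commutator of two generators is a power of `q`, which dies modulo scalars. -/
theorem commute_mk_z (hq0 : q ≠ 0) (i j : Fin r) :
    Commute (QuotientGroup.mk' (scalars q L) (z q L i))
      (QuotientGroup.mk' (scalars q L) (z q L j)) := by
  rw [Commute, SemiconjBy, ← map_mul, ← map_mul]
  refine (QuotientGroup.eq.2 ?_).symm
  rw [mem_scalars]
  refine ⟨Units.mk0 (q ^ skew L i j) (zpow_ne_zero _ hq0), ?_⟩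
  rw [Units.val_mul, Units.inv_mul_eq_iff_eq_mul, Units.val_mul, Units.val_mul, z_mul_z hq0,
    Units.val_mk0, ← Algebra.commutes, Algebra.smul_def]

/-- The group homomorphism from the lattice of degrees to the units modulo scalars. -/
def degreeHom (hq0 : q ≠ 0) :
    (Fin r → Multiplicative ℤ) →* (QuasiLaurent q L)ˣ ⧸ scalars q L :=
  MonoidHom.noncommPiCoprod (fun j => zpowersHom _ (QuotientGroup.mk' (scalars q L) (z q L j)))
    fun i j _ m n => by
      simp only [zpowersHom_apply]
      exact ((commute_mk_z hq0 i j).zpow_left _).zpow_right _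

/-- Modulo scalars the generators commute, so the class of a monomial is determined by its degree.
This replaces any explicit normal ordering. -/
theorem HasDegree.mk_eq (hq0 : q ≠ 0) {x : (QuasiLaurent q L)ˣ} {a : Fin r → ℤ}
    (h : HasDegree q L x a) :
    (x : (QuasiLaurent q L)ˣ ⧸ scalars q L) =
      degreeHom hq0 (fun j => Multiplicative.ofAdd (a j)) := by
  induction h with
  | one => exact (map_one (degreeHom hq0)).symm
  | z j =>
    have : (fun i => Multiplicative.ofAdd ((Pi.single j 1 : Fin r → ℤ) i)) =
        Pi.mulSingle j (Multiplicative.ofAdd 1) := by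
      ext i
      by_cases hij : i = j
      · subst hij; simp
      · simp [hij]
    rw [this]
    refine Eq.symm ((MonoidHom.noncommPiCoprod_mulSingle _ _ _).trans ?_)
    simp
  | mul _ _ ihx ihy => 
    rw [QuotientGroup.mk_mul, ihx, ihy, ← map_mul]
    rfl
  | inv _ ih =>
    rw [QuotientGroup.mk_inv, ih, ← map_inv]
    rfl

theorem HasDegree.eq_smul (hq0 : q ≠ 0) {x y : (QuasiLaurent q L)ˣ} {a : Fin r → ℤ}
    (hx : HasDegree q L x a) (hy : HasDegree q L y a) :
    ∃ c : ℂ, (y : QuasiLaurent q L) = c • (x : QuasiLaurent q L) := by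
  have h : (x : (QuasiLaurent q L)ˣ ⧸ scalars q L) = y := by rw [hx.mk_eq hq0, hy.mk_eq hq0]
  obtain ⟨c, hc⟩ := mem_scalars.1 (QuotientGroup.eq.1 h)
  refine ⟨c, ?_⟩
  rw [Units.val_mul, Units.inv_mul_eq_iff_eq_mul] at hc
  rw [hc, ← Algebra.commutes, Algebra.smul_def]

/-! ### The units with a degree span -/

theorem span_hasDegree :
    Submodule.span ℂ {x : QuasiLaurent q L | ∃ u a, HasDegree q L u a ∧ x = u} = ⊤ := by
  set T := Submodule.span ℂ {x : QuasiLaurent q L | ∃ u a, HasDegree q L u a ∧ x = u} with hT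
  have hmem : ∀ u a, HasDegree q L u a → (u : QuasiLaurent q L) ∈ T := fun u a h =>
    Submodule.subset_span ⟨u, a, h, rfl⟩
  have hone : (1 : QuasiLaurent q L) ∈ T := hmem 1 0 HasDegree.one
  -- The set of monomials is closed under multiplication, hence so is its span.
  have hmul : ∀ x y, x ∈ T → y ∈ T → x * y ∈ T := fun x y hx hy => by
    have h := Submodule.mul_mem_mul hx hy
    rw [hT, Submodule.span_mul_span] at h
    refine Submodule.span_mono ?_ h
    rintro _ ⟨_, ⟨u, a, hu, rfl⟩, _, ⟨v, b, hv, rfl⟩, rfl⟩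
    exact ⟨u * v, a + b, hu.mul hv, rfl⟩
  rw [eq_top_iff]
  rintro x -
  obtain ⟨y, rfl⟩ : ∃ y, mk q L y = x := RingQuot.mkAlgHom_surjective ℂ (QuasiLaurentRel q L) x
  induction y using FreeAlgebra.induction with
  | grade0 c =>
    rw [AlgHom.commutes, Algebra.algebraMap_eq_smul_one]
    exact T.smul_mem _ hone
  | grade1 i =>
    cases i with
    | inl j => exact hmem (z q L j) _ (HasDegree.z j)
    | inr j => exact hmem (z q L j)⁻¹ _ (HasDegree.z j).inv
  | mul x y hx hy => rw [map_mul]; exact hmul _ _ hx hy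
  | add x y hx hy => rw [map_add]; exact T.add_mem hx hy

/-! ### The action on Laurent polynomials, and linear independence -/

/-- The weighted shift `e_a ↦ q ^ c a • e_(a + d)`. -/
def shift (q : ℂ) (c : (Fin r → ℤ) → ℤ) (d : Fin r → ℤ) : Module.End ℂ ((Fin r → ℤ) →₀ ℂ) :=
  Finsupp.linearCombination ℂ fun a => Finsupp.single (a + d) (q ^ c a)

theorem shift_single (c : (Fin r → ℤ) → ℤ) (d a : Fin r → ℤ) (x : ℂ) :
    shift q c d (Finsupp.single a x) = Finsupp.single (a + d) (x * q ^ c a) := by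
  simp [shift]

/-- The exponent of the scalar by which `z_j` acts on the basis vector of degree `a`. -/
def actionExponent (L : Fin r → Fin r → ℤ) (j : Fin r) (a : Fin r → ℤ) : ℤ :=
  -∑ i, if i < j then L i j * a i else 0

theorem actionExponent_add_single (i j : Fin r) (a : Fin r → ℤ) (m : ℤ) :
    actionExponent L j (a + Pi.single i m) =
      actionExponent L j a - if i < j then L i j * m else 0 := by
  have : ∀ k, (if k < j then L k j * (a + Pi.single i m : Fin r → ℤ) k else 0) =
      (if k < j then L k j * a k else 0) + if k = i then (if i < j then L i j * m else 0) else 0 := by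
    intro k
    by_cases hk : k = i
    · subst hk
      by_cases h : k < j <;> simp [h, mul_add]
    · simp [hk]
  simp only [actionExponent, this, Finset.sum_add_distrib, Finset.sum_ite_eq', Finset.mem_univ,
    if_true]
  ring

/-- The action of the quasi-Laurent algebra on Laurent polynomials. -/
def action (hq0 : q ≠ 0) (L : Fin r → Fin r → ℤ) :
    QuasiLaurent q L →ₐ[ℂ] Module.End ℂ ((Fin r → ℤ) →₀ ℂ) :=
  -- This models left multiplication on ordered monomials: moving `z_j` into place past `z_i ^ a_i`
  -- for `i < j` costs `q ^ (-L i j * a i)`. The exponent does not involve `a j`, so the inverse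
  -- shift carries just the negated exponent.
  RingQuot.liftAlgHom ℂ ⟨FreeAlgebra.lift ℂ (Sum.elim
      (fun j => shift q (actionExponent L j) (Pi.single j 1))
      (fun j => shift q (fun a => -actionExponent L j a) (Pi.single j (-1)))), by
    intro x y h
    induction h with
    | mul_inv j =>
      refine Finsupp.lhom_ext fun a x => ?_
      simp only [map_mul, map_one, FreeAlgebra.lift_ι_apply, Sum.elim_inl, Sum.elim_inr,
        Module.End.mul_apply, Module.End.one_apply, shift_single, actionExponent_add_single,
        lt_self_iff_false, if_false, sub_zero, add_assoc, ← Pi.single_add, mul_assoc,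
        ← zpow_add₀ hq0]
      simp
    | inv_mul j =>
      refine Finsupp.lhom_ext fun a x => ?_
      simp only [map_mul, map_one, FreeAlgebra.lift_ι_apply, Sum.elim_inl, Sum.elim_inr,
        Module.End.mul_apply, Module.End.one_apply, shift_single, actionExponent_add_single,
        lt_self_iff_false, if_false, sub_zero, add_assoc, ← Pi.single_add, mul_assoc,
        ← zpow_add₀ hq0]
      simp
    | comm i j hij =>
      refine Finsupp.lhom_ext fun a x => ?_
      simp only [map_mul, map_smul, FreeAlgebra.lift_ι_apply, Sum.elim_inl, Module.End.mul_apply,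
        LinearMap.smul_apply, shift_single, actionExponent_add_single, hij, hij.not_gt, if_true,
        if_false, Finsupp.smul_single, smul_eq_mul, sub_zero, mul_one, zpow_sub₀ hq0]
      rw [add_right_comm]
      congr 1
      field_simp⟩

theorem action_z (hq0 : q ≠ 0) (j : Fin r) :
    action hq0 L (z q L j) = shift q (actionExponent L j) (Pi.single j 1) := by
  have h : action hq0 L (mk q L (FreeAlgebra.ι ℂ (Sum.inl j))) = FreeAlgebra.lift ℂ (Sum.elim
      (fun j => shift q (actionExponent L j) (Pi.single j 1))
      (fun j => shift q (fun a => -actionExponent L j a) (Pi.single j (-1))))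
        (FreeAlgebra.ι ℂ (Sum.inl j)) := RingQuot.liftAlgHom_mkAlgHom_apply ..
  rw [FreeAlgebra.lift_ι_apply, Sum.elim_inl] at h
  exact h

theorem HasDegree.action_single (hq0 : q ≠ 0) {x : (QuasiLaurent q L)ˣ} {a : Fin r → ℤ}
    (h : HasDegree q L x a) (b : Fin r → ℤ) :
    ∃ c : ℂ, c ≠ 0 ∧ action hq0 L x (Finsupp.single b 1) = Finsupp.single (b + a) c := by
  induction h generalizing b with
  | one => exact ⟨1, one_ne_zero, by simp⟩
  | z j => exact ⟨_, zpow_ne_zero _ hq0, by rw [action_z, shift_single, one_mul]⟩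
  | @mul x y a a' _ _ ihx ihy =>
    obtain ⟨c, hc, h⟩ := ihy b
    obtain ⟨c', hc', h'⟩ := ihx (b + a')
    refine ⟨c * c', mul_ne_zero hc hc', ?_⟩
    rw [Units.val_mul, map_mul, Module.End.mul_apply, h, ← mul_one c, ← smul_eq_mul,
      ← Finsupp.smul_single, map_smul, h', Finsupp.smul_single, smul_eq_mul, smul_eq_mul, mul_one,
      add_assoc, add_comm a']
  | @inv x a _ ih =>
    obtain ⟨c, hc, h⟩ := ih (b + -a)
    refine ⟨c⁻¹, inv_ne_zero hc, ?_⟩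
    -- The basis vector is exhibited in the image of `x`, so that `x⁻¹` can be cancelled against
    -- `x`.
    have h1 : Finsupp.single b (1 : ℂ) =
        c⁻¹ • action hq0 L x (Finsupp.single (b + -a) 1) := by
      rw [h, Finsupp.smul_single, smul_eq_mul, inv_mul_cancel₀ hc, neg_add_cancel_right]
    rw [h1, map_smul, ← Module.End.mul_apply, ← map_mul, Units.inv_mul, map_one,
      Module.End.one_apply, Finsupp.smul_single, smul_eq_mul, mul_one]

/-- Applied to the basis vector of degree `0`, monomials of distinct degrees become nonzero
multiples of distinct basis vectors. -/
theorem HasDegree.linearIndependent (hq0 : q ≠ 0) {κ : Type*} {x : κ → (QuasiLaurent q L)ˣ}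
    {d : κ → Fin r → ℤ} (h : ∀ k, HasDegree q L (x k) (d k)) (hd : Function.Injective d) :
    LinearIndependent ℂ fun k => (x k : QuasiLaurent q L) := by
  choose c hc hx using fun k => (h k).action_single hq0 0
  let f : QuasiLaurent q L →ₗ[ℂ] ((Fin r → ℤ) →₀ ℂ) :=
    (LinearMap.applyₗ (Finsupp.single 0 1)).comp (action hq0 L).toLinearMap
  refine LinearIndependent.of_comp f ?_
  have hb : LinearIndependent ℂ fun k => Finsupp.single (d k) (1 : ℂ) :=
    (Finsupp.linearIndependent_single_one ℂ (Fin r → ℤ)).comp d hd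
  have : f ∘ (fun k => (x k : QuasiLaurent q L)) =
      (fun k => Units.mk0 (c k) (hc k)) • fun k => Finsupp.single (d k) (1 : ℂ) := by
    ext1 k
    simp only [Function.comp_apply, Pi.smul_apply', Units.smul_mk0, Finsupp.smul_single,
      smul_eq_mul, mul_one]
    rw [← zero_add (d k)]
    exact hx k
  rw [this]
  exact hb.units_smul _

/-! ### The center -/

theorem mem_center_iff {x : QuasiLaurent q L} :
    x ∈ Subalgebra.center ℂ (QuasiLaurent q L) ↔ ∀ j, x * z q L j = z q L j * x := by
  rw [Subalgebra.mem_center_iff]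
  refine ⟨fun h j => (h _).symm, fun h y => ?_⟩
  have hy : y ∈ Submodule.span ℂ {x : QuasiLaurent q L | ∃ u a, HasDegree q L u a ∧ x = u} := by
    rw [span_hasDegree]; trivial
  induction hy using Submodule.span_induction with
  | mem y hy =>
    obtain ⟨u, a, hu, rfl⟩ := hy
    change Commute _ _
    induction hu with
    | one => exact Commute.one_left x
    | z j => exact (h j).symm
    | mul _ _ ih₁ ih₂ => exact ih₁.mul_left ih₂
    | inv _ ih => exact ih.units_inv_left
  | zero => simp
  | add y y' _ _ h₁ h₂ => rw [add_mul, mul_add, h₁, h₂]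
  | smul c y _ h => rw [smul_mul_assoc, mul_smul_comm, h]

theorem zpow_eq_one_iff (hq : ∀ k : ℕ, 0 < k → q ^ k ≠ 1) (m : ℤ) : q ^ m = 1 ↔ m = 0 := by
  refine ⟨fun h => ?_, fun h => by simp [h]⟩
  by_contra hm
  refine hq m.natAbs (Int.natAbs_pos.2 hm) ?_
  rcases Int.natAbs_eq m with h' | h' <;> rw [h'] at h
  · rwa [zpow_natCast] at h
  · rwa [zpow_neg, zpow_natCast, inv_eq_one] at h

theorem HasDegree.mem_center_iff (hq0 : q ≠ 0) (hq : ∀ k : ℕ, 0 < k → q ^ k ≠ 1)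
    {x : (QuasiLaurent q L)ˣ} {a : Fin r → ℤ} (h : HasDegree q L x a) :
    (x : QuasiLaurent q L) ∈ Subalgebra.center ℂ (QuasiLaurent q L) ↔
      ∀ j, ∑ i, a i * skew L i j = 0 := by
  -- Independence of a one-element family shows that this unit is nonzero, i.e. that the algebra is
  -- not trivial.
  have hne : ∀ j, ((QuasiLaurent.z q L j : QuasiLaurent q L) * x) ≠ 0 := fun j => by
    have hu := HasDegree.linearIndependent hq0 (fun _ : Unit => (HasDegree.z j).mul h)
      (Function.injective_of_subsingleton _)
    exact hu.ne_zero ()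
  rw [QuasiLaurent.mem_center_iff]
  refine forall_congr' fun j => ?_
  rw [h.mul_z hq0, ← zpow_eq_one_iff hq]
  refine ⟨fun h => ?_, fun h => by rw [h, one_smul]⟩
  exact smul_left_injective ℂ (hne j) (by simpa using h)

/-- The center is spanned by the central units with a degree. -/
theorem center_eq_span (hq0 : q ≠ 0) (hq : ∀ k : ℕ, 0 < k → q ^ k ≠ 1)
    (x : (Fin r → ℤ) → (QuasiLaurent q L)ˣ) (hx : ∀ a, HasDegree q L (x a) a) :
    Subalgebra.toSubmodule (Subalgebra.center ℂ (QuasiLaurent q L)) =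
      Submodule.span ℂ ((fun a => (x a : QuasiLaurent q L)) ''
        {a | ∀ j, ∑ i, a i * skew L i j = 0}) := by
  apply le_antisymm
  · intro y hy
    rw [Subalgebra.mem_toSubmodule, QuasiLaurent.mem_center_iff] at hy
    have hspan : y ∈ Submodule.span ℂ (Set.range fun a => (x a : QuasiLaurent q L)) := by
      have : y ∈ Submodule.span ℂ {x : QuasiLaurent q L | ∃ u a, HasDegree q L u a ∧ x = u} := by
        rw [span_hasDegree]; trivial
      refine Submodule.span_le.2 ?_ this
      rintro _ ⟨u, a, hu, rfl⟩
      obtain ⟨c, hc⟩ := (hx a).eq_smul hq0 hu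
      rw [hc]
      exact Submodule.smul_mem _ _ (Submodule.subset_span ⟨a, rfl⟩)
    obtain ⟨f, rfl⟩ := (Finsupp.mem_span_range_iff_exists_finsupp).1 hspan
    refine Submodule.sum_mem _ fun a ha => Submodule.smul_mem _ _
      (Submodule.subset_span ⟨a, fun j => ?_, rfl⟩)
    -- Left multiplication by `z_j` translates degrees injectively, so the commutator with `z_j` can
    -- vanish only term by term.
    have hli := HasDegree.linearIndependent hq0 (fun a => (HasDegree.z j).mul (hx a))
      (add_right_injective _)
    have h0 : ∑ a ∈ f.support, (f a * (q ^ (∑ i, a i * skew L i j) - 1)) •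
        ((z q L j * x a : (QuasiLaurent q L)ˣ) : QuasiLaurent q L) = 0 := by
      have := hy j
      rw [Finsupp.sum, Finset.sum_mul, Finset.mul_sum, ← sub_eq_zero,
        ← Finset.sum_sub_distrib] at this
      rw [← this]
      refine Finset.sum_congr rfl fun a _ => ?_
      rw [smul_mul_assoc, (hx a).mul_z hq0, mul_smul_comm, mul_sub, sub_smul, mul_one, mul_smul,
        Units.val_mul]
    have := linearIndependent_iff'.1 hli f.support _ h0 a ha
    rcases mul_eq_zero.1 this with h | h
    · exact absurd h (Finsupp.mem_support_iff.1 ha)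
    · exact (zpow_eq_one_iff hq _).1 (sub_eq_zero.1 h)
  · rw [Submodule.span_le]
    rintro _ ⟨a, ha, rfl⟩
    exact ((hx a).mem_center_iff hq0 hq).2 ha

end QuasiLaurent

/-! ### Root-system side: the kernel of the commutation matrix -/

section Words

variable {ι V N : Type*} [AddCommGroup V] [Module ℝ V] [AddCommGroup N] [Module ℝ N]
  {P : RootPairing ι ℝ V N} (b : P.Base)

/-! ### Words and partial sums of their roots -/

theorem weylElt_nil (x : V) : weylElt b [] x = x := rfl

theorem weylElt_cons (s : b.support) (w : List b.support) (x : V) :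
    weylElt b (s :: w) x = P.reflection (s : ι) (weylElt b w x) := by
  simp [weylElt]

theorem weylElt_append (v w : List b.support) (x : V) :
    weylElt b (v ++ w) x = weylElt b v (weylElt b w x) := by
  induction v with
  | nil => rfl
  | cons s v ih => rw [List.cons_append, weylElt_cons, weylElt_cons, ih]

theorem weylElt_take_succ (w : List b.support) (j : Fin w.length) (x : V) :
    weylElt b (w.take (j + 1)) x = weylElt b (w.take j) (P.reflection (w.get j) x) := by
  rw [← List.take_append_getElem j.isLt, weylElt_append, weylElt_cons, weylElt_nil]
  rfl

theorem root_mem_wordSpan {w : List b.support} {s : b.support} (hs : s ∈ w) :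
    P.root s ∈ wordSpan b w :=
  Submodule.subset_span ⟨s, hs, rfl⟩

theorem weylElt_mem_wordSpan {w v : List b.support} (hv : ∀ s ∈ v, s ∈ w) {x : V}
    (hx : x ∈ wordSpan b w) : weylElt b v x ∈ wordSpan b w := by
  induction v with
  | nil => exact hx
  | cons s v ih =>
    have h := ih fun t ht => hv t (List.mem_cons_of_mem _ ht)
    rw [weylElt_cons, P.reflection_apply]
    exact Submodule.sub_mem _ h (Submodule.smul_mem _ _ (root_mem_wordSpan b (hv s (by simp))))

theorem beta_mem_wordSpan (w : List b.support) (j : Fin w.length) :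
    beta b w j ∈ wordSpan b w :=
  weylElt_mem_wordSpan b (fun _ hs => List.mem_of_mem_take hs)
    (root_mem_wordSpan b (List.get_mem w j))

/-- The partial sum `∑ a_j β_j` over the positions `j < k`. -/
def partialSum (w : List b.support) (a : Fin w.length → ℝ) (k : ℕ) : V :=
  ∑ j : Fin w.length, if (j : ℕ) < k then a j • beta b w j else 0

/-- The sum `∑ a_j β_j` over all positions. -/
def totalSum (w : List b.support) (a : Fin w.length → ℝ) : V :=
  ∑ j, a j • beta b w j

theorem partialSum_zero (w : List b.support) (a : Fin w.length → ℝ) : partialSum b w a 0 = 0 := by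
  simp [partialSum]

theorem partialSum_length (w : List b.support) (a : Fin w.length → ℝ) :
    partialSum b w a w.length = totalSum b w a := by
  simp [partialSum, totalSum]

theorem partialSum_succ (w : List b.support) (a : Fin w.length → ℝ) (i : Fin w.length) :
    partialSum b w a (i + 1) = partialSum b w a i + a i • beta b w i := by
  have h : ∀ j : Fin w.length, (if (j : ℕ) < i + 1 then a j • beta b w j else 0) =
      (if (j : ℕ) < i then a j • beta b w j else 0) + if j = i then a i • beta b w i else 0 := by
    intro j
    rcases lt_trichotomy (j : ℕ) i with hj | hj | hj
    · rw [if_pos (by omega), if_pos hj, if_neg (by rintro rfl; omega), add_zero]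
    · obtain rfl := Fin.ext hj
      simp
    · rw [if_neg (by omega), if_neg (by omega), if_neg (by rintro rfl; omega), add_zero]
  simp only [partialSum, h, Finset.sum_add_distrib, Finset.sum_ite_eq', Finset.mem_univ, if_true]

theorem totalSum_mem_wordSpan (w : List b.support) (a : Fin w.length → ℝ) :
    totalSum b w a ∈ wordSpan b w :=
  Submodule.sum_mem _ fun j _ => Submodule.smul_mem _ _ (beta_mem_wordSpan b w j)

theorem mem_kerOnePlus_iff {w : List b.support} {x : V} :
    x ∈ kerOnePlus b w ↔ x ∈ wordSpan b w ∧ weylElt b w x = -x := by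
  rw [kerOnePlus, Submodule.mem_inf, LinearMap.mem_ker, LinearMap.add_apply, LinearMap.id_apply,
    eq_neg_iff_add_eq_zero, add_comm x]
  rfl

/-- A telescoping sum: lengthening the prefix by the letter `s` changes the image of `x` by `-⟨x,
α_s^∨⟩ β_j`. -/
theorem partialSum_eq_sub_weylElt (w : List b.support) (n : b.support → ℝ) {x : V}
    (hx : ∀ s ∈ w, P.toLinearMap x (P.coroot (s : ι)) = n s) (k : ℕ) (hk : k ≤ w.length) :
    partialSum b w (fun i => n (w.get i)) k = x - weylElt b (w.take k) x := by
  induction k with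
  | zero => simp [partialSum_zero, weylElt]
  | succ k ih =>
    have hs := partialSum_succ b w (fun i => n (w.get i)) ⟨k, hk⟩
    have ht := weylElt_take_succ b w ⟨k, hk⟩ x
    have hc : P.coroot' (w.get ⟨k, hk⟩ : ι) x = n (w.get ⟨k, hk⟩) := hx _ (List.get_mem w _)
    simp only at hs ht
    rw [hs, ht, P.reflection_apply, hc, map_sub, ih (by omega), map_smul, beta]
    abel

/-- The same telescoping with `x = T`, where each pairing equals `2 a_j`. Only the positions before
`k` are needed, so the identity is available inside an induction on the position. -/
theorem totalSum_sub_partialSum (w : List b.support) (a : Fin w.length → ℝ) (k : ℕ)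
    (hk : k ≤ w.length) (h : ∀ j : Fin w.length, (j : ℕ) < k →
      P.toLinearMap (totalSum b w a) (P.coroot (w.get j : ι)) = 2 * a j) :
    totalSum b w a - (2 : ℝ) • partialSum b w a k = weylElt b (w.take k) (totalSum b w a) := by
  induction k with
  | zero => simp [partialSum_zero, weylElt]
  | succ k ih =>
    have hs := partialSum_succ b w a ⟨k, hk⟩
    have ht := weylElt_take_succ b w ⟨k, hk⟩ (totalSum b w a)
    have hc : P.coroot' (w.get ⟨k, hk⟩ : ι) (totalSum b w a) = 2 * a ⟨k, hk⟩ :=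
      h ⟨k, hk⟩ k.lt_succ_self
    simp only at hs ht
    rw [hs, ht, P.reflection_apply, hc, map_sub, ← ih (by omega) fun j hj => h j (by omega),
      map_smul, beta]
    module

variable [Fintype ι]

/-! ### The invariant form and the span of a word -/

theorem normForm_comm (x y : V) : normForm P x y = normForm P y x := by
  rw [normForm_apply, normForm_apply, ← P.rootForm_symmetric.eq x y]
  simp

theorem normForm_root_self_ne_zero (i : ι) : normForm P (P.root i) (P.root i) ≠ 0 := by
  have : Nonempty ι := ⟨i⟩
  linarith [(normForm_short P).2 i]

theorem normForm_reflection (i : ι) (x y : V) :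
    normForm P (P.reflection i x) (P.reflection i y) = normForm P x y := by
  rw [normForm_apply, normForm_apply, P.rootForm_reflection_reflection_apply]

/-- Invariance under the reflection in `α_i`, which negates `α_i`, compares the two sides. -/
theorem two_mul_normForm_root (i : ι) (x : V) :
    2 * normForm P x (P.root i) =
      P.toLinearMap x (P.coroot i) * normForm P (P.root i) (P.root i) := by
  have h := normForm_reflection (P := P) i x (P.root i)
  rw [P.reflection_apply_self, P.reflection_apply, map_neg, map_sub, LinearMap.sub_apply, map_smul,
    LinearMap.smul_apply, smul_eq_mul] at h
  change -(_ - P.toLinearMap x (P.coroot i) * _) = _ at h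
  linarith

theorem normForm_root_eq_zero_iff (i : ι) (x : V) :
    normForm P x (P.root i) = 0 ↔ P.toLinearMap x (P.coroot i) = 0 := by
  have h := two_mul_normForm_root (P := P) i x
  have h0 := normForm_root_self_ne_zero (P := P) i
  constructor <;> intro hx
  · rw [hx, mul_zero, eq_comm, mul_eq_zero] at h
    exact h.resolve_right h0
  · rw [hx, zero_mul] at h
    exact (mul_eq_zero.1 h).resolve_left two_ne_zero

theorem normForm_weylElt (w : List b.support) (x y : V) :
    normForm P (weylElt b w x) (weylElt b w y) = normForm P x y := by
  induction w with
  | nil => rfl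
  | cons s w ih =>
    rw [weylElt_cons, weylElt_cons, normForm_reflection, ih]

theorem mem_orthogonal_wordSpan_iff (w : List b.support) (x : V) :
    x ∈ (normForm P).orthogonal (wordSpan b w) ↔
      ∀ s ∈ w, P.toLinearMap x (P.coroot (s : ι)) = 0 := by
  simp only [← normForm_root_eq_zero_iff]
  constructor
  · intro h s hs
    rw [normForm_comm]
    exact h _ (root_mem_wordSpan b hs)
  · intro h y hy
    change normForm P y x = 0
    rw [wordSpan] at hy
    induction hy using Submodule.span_induction with
    | mem y hy =>
      obtain ⟨s, hs, rfl⟩ := hy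
      rw [normForm_comm]
      exact h s hs
    | zero => simp
    | add y z _ _ h₁ h₂ => simp [h₁, h₂]
    | smul c y _ h₁ => simp [h₁]

/-- The difference lies in `S_𝔯` and in its orthogonal complement, which meet only in `0`. -/
theorem eq_of_coroot_eq [P.IsRootSystem] {w : List b.support} {x y : V} (hx : x ∈ wordSpan b w)
    (hy : y ∈ wordSpan b w) (h : ∀ s ∈ w, P.toLinearMap x (P.coroot (s : ι)) =
      P.toLinearMap y (P.coroot (s : ι))) : x = y := by
  rw [← sub_eq_zero]
  refine Submodule.disjoint_def.1 (isCompl_wordSpan b w).disjoint _ (Submodule.sub_mem _ hx hy)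
    ((mem_orthogonal_wordSpan_iff b w _).2 fun s hs => ?_)
  rw [map_sub, LinearMap.sub_apply, h s hs, sub_self]

theorem restrictedWeight_mem [P.IsRootSystem] (w : List b.support) (n : b.support → ℤ) :
    restrictedWeight b w n ∈ wordSpan b w :=
  Submodule.projection_apply_mem _ _

theorem restrictWeight_coroot [P.IsRootSystem] (w : List b.support) (x : V) {s : b.support}
    (hs : s ∈ w) : P.toLinearMap (restrictWeight b w x) (P.coroot (s : ι)) =
      P.toLinearMap x (P.coroot (s : ι)) := by
  have h : x - restrictWeight b w x ∈ (normForm P).orthogonal (wordSpan b w) := by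
    rw [← Submodule.projection_apply_eq_zero_iff (isCompl_wordSpan b w), map_sub, sub_eq_zero]
    exact (Submodule.projection_apply_of_mem_left _ (Submodule.projection_apply_mem _ _)).symm
  have := (mem_orthogonal_wordSpan_iff b w _).1 h s hs
  rw [map_sub, LinearMap.sub_apply, sub_eq_zero] at this
  exact this.symm

theorem restrictedWeight_coroot [P.IsRootSystem] (w : List b.support) (n : b.support → ℤ)
    {s : b.support} (hs : s ∈ w) :
    P.toLinearMap (restrictedWeight b w n) (P.coroot (s : ι)) = n s := by
  classical
  rw [restrictedWeight, restrictWeight_coroot b w _ hs]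
  simp [fundWeight_coroot, LinearMap.sum_apply]

/-! ### Degrees in the kernel of the commutation matrix -/

/-- The matrix carries sign `+` for `i < j` and `-` for `i > j`, while `T - 2 P_j - a_j β_j` is the
sum over later positions minus the sum over earlier ones. -/
theorem sum_mul_skew [P.IsCrystallographic] [P.IsReduced] [P.IsIrreducible]
    (w : List b.support) (a : Fin w.length → ℤ) (j : Fin w.length) :
    ((∑ i, a i * QuasiLaurent.skew (commExponent b w) i j : ℤ) : ℝ) =
      -normForm P (totalSum b w (fun i => a i) - (2 : ℝ) • partialSum b w (fun i => a i) j -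
        (a j : ℝ) • beta b w j) (beta b w j) := by
  -- The sign of `i` relative to `j` is written as `2[i < j] + [i = j] - 1`.
  have h : ∀ i, ((a i * QuasiLaurent.skew (commExponent b w) i j : ℤ) : ℝ) =
      normForm P (((2 : ℝ) • if (i : ℕ) < j then (a i : ℝ) • beta b w i else 0) +
        (if i = j then (a j : ℝ) • beta b w j else 0) - (a i : ℝ) • beta b w i) (beta b w j) := by
    intro i
    rcases lt_trichotomy i j with hij | rfl | hij
    · have hij' : (i : ℕ) < j := hij
      rw [QuasiLaurent.skew, if_pos hij, if_pos hij', if_neg hij.ne]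
      push_cast
      rw [commExponent_eq]
      simp
      ring
    · simp [QuasiLaurent.skew]
    · have hij' : ¬ (i : ℕ) < j := not_lt.2 (le_of_lt hij)
      rw [QuasiLaurent.skew, if_neg hij.not_gt, if_pos hij, if_neg hij', if_neg hij.ne']
      push_cast
      rw [commExponent_eq, normForm_comm]
      simp
  push_cast at h ⊢
  rw [Finset.sum_congr rfl fun i _ => h i, ← LinearMap.sum_apply, ← map_sum, ← LinearMap.neg_apply,
    ← map_neg, Finset.sum_sub_distrib, Finset.sum_add_distrib, ← Finset.smul_sum]
  simp only [Finset.sum_ite_eq', Finset.mem_univ, if_true]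
  congr 2
  simp only [totalSum, partialSum]
  abel

/-- If `y = σ_{i_1} ⋯ σ_{i_{j-1}} x`, then `y - a β_j` is orthogonal to `β_j` if and only if
`2 a = ⟨x, α_{i_j}^∨⟩`. -/
theorem normForm_beta_eq_zero_iff (w : List b.support) (j : Fin w.length) (x : V) (a : ℝ) :
    normForm P (weylElt b (w.take j) x - a • beta b w j) (beta b w j) = 0 ↔
      P.toLinearMap x (P.coroot (w.get j : ι)) = 2 * a := by
  rw [beta, ← map_smul, ← map_sub, normForm_weylElt, normForm_root_eq_zero_iff, map_sub,
    LinearMap.sub_apply, map_smul, LinearMap.smul_apply, P.root_coroot_two, sub_eq_zero,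
    smul_eq_mul, mul_comm]

/-- The two systems match one equation at a time, once all earlier equations of the second system
are known; hence the induction on the position. -/
theorem sum_mul_skew_eq_zero_iff [P.IsCrystallographic] [P.IsReduced] [P.IsIrreducible]
    (w : List b.support) (a : Fin w.length → ℤ) :
    (∀ j, ∑ i, a i * QuasiLaurent.skew (commExponent b w) i j = 0) ↔
      ∀ j, P.toLinearMap (totalSum b w fun i => a i) (P.coroot (w.get j : ι)) = 2 * (a j : ℝ) := by
  have key : ∀ j : Fin w.length, (∀ i : Fin w.length, (i : ℕ) < j →
      P.toLinearMap (totalSum b w fun i => a i) (P.coroot (w.get i : ι)) = 2 * (a i : ℝ)) →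
      (∑ i, a i * QuasiLaurent.skew (commExponent b w) i j = 0 ↔
        P.toLinearMap (totalSum b w fun i => a i) (P.coroot (w.get j : ι)) = 2 * (a j : ℝ)) := by
    intro j h
    rw [← normForm_beta_eq_zero_iff, ← totalSum_sub_partialSum b w _ j j.isLt.le h,
      ← Int.cast_eq_zero (α := ℝ), sum_mul_skew, neg_eq_zero]
  constructor
  · intro h
    have : ∀ k : ℕ, ∀ j : Fin w.length, (j : ℕ) < k →
        P.toLinearMap (totalSum b w fun i => a i) (P.coroot (w.get j : ι)) = 2 * (a j : ℝ) := by
      intro k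
      induction k with
      | zero => intro j hj; omega
      | succ k ih =>
        intro j hj
        exact (key j fun i hi => ih i (by omega)).1 (h j)
    exact fun j => this _ j j.isLt
  · intro h j
    exact (key j fun i _ => h i).2 (h j)

theorem sum_mul_skew_eq_zero_iff_restrictedWeight [P.IsRootSystem] [P.IsCrystallographic]
    [P.IsReduced] [P.IsIrreducible] (w : List b.support) (n : b.support → ℤ) :
    (∀ j, ∑ i, n (w.get i) * QuasiLaurent.skew (commExponent b w) i j = 0) ↔
      restrictedWeight b w n ∈ kerOnePlus b w := by
  rw [sum_mul_skew_eq_zero_iff b w fun i => n (w.get i), mem_kerOnePlus_iff]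
  have hμ : ∀ s ∈ w, P.toLinearMap (restrictedWeight b w n) (P.coroot (s : ι)) = (n s : ℝ) :=
    fun s hs => restrictedWeight_coroot b w n hs
  constructor
  · intro h
    refine ⟨restrictedWeight_mem b w n, ?_⟩
    -- Both vectors lie in `S_𝔯` and pair with each coroot of the word to `2 n_s`.
    have h2 : totalSum b w (fun i => (n (w.get i) : ℝ)) = (2 : ℝ) • restrictedWeight b w n := by
      refine eq_of_coroot_eq b (totalSum_mem_wordSpan b w _)
        (Submodule.smul_mem _ _ (restrictedWeight_mem b w n)) fun s hs => ?_
      obtain ⟨j, rfl⟩ := List.get_of_mem hs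
      rw [h j, map_smul, LinearMap.smul_apply, hμ _ hs, smul_eq_mul]
    -- At the full length the partial sum is `T` itself, so `-T = ωT` with `T = 2μ`.
    have h3 := totalSum_sub_partialSum b w _ w.length le_rfl fun j _ => h j
    rw [partialSum_length, List.take_length, h2, map_smul] at h3
    refine smul_right_injective V (two_ne_zero' ℝ) ?_
    simp only
    rw [← h3]
    module
  · rintro ⟨-, h⟩ j
    -- Here `T = μ - ωμ = 2μ`.
    have h2 := partialSum_eq_sub_weylElt b w (fun s => (n s : ℝ)) hμ w.length le_rfl
    rw [partialSum_length, List.take_length, h, sub_neg_eq_add, ← two_smul ℝ] at h2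
    rw [h2, map_smul, LinearMap.smul_apply, hμ _ (List.get_mem w j), smul_eq_mul]

/-- A degree in the kernel of the commutation matrix depends only on the letters of the word. -/
theorem exists_exponents [P.IsCrystallographic] [P.IsReduced] [P.IsIrreducible]
    (w : List b.support) (a : Fin w.length → ℤ)
    (h : ∀ j, ∑ i, a i * QuasiLaurent.skew (commExponent b w) i j = 0) :
    ∃ n ∈ Exponents b w, a = fun i => n (w.get i) := by
  classical
  rw [sum_mul_skew_eq_zero_iff] at h
  have hex : ∀ s : b.support, ∃ m : ℤ, (s ∉ w → m = 0) ∧ ∀ i, w.get i = s → a i = m := by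
    intro s
    by_cases hs : s ∈ w
    · obtain ⟨j, rfl⟩ := List.get_of_mem hs
      refine ⟨a j, fun h => absurd hs h, fun i hi => ?_⟩
      -- Equal letters have the same coroot, so `2 a_i` and `2 a_j` are the same pairing with `T`.
      have hij := (h i).symm.trans ((congrArg _ (by rw [hi])).trans (h j))
      exact_mod_cast mul_left_cancel₀ two_ne_zero hij
    · exact ⟨0, fun _ => rfl, fun i hi => absurd (hi ▸ List.get_mem w i) hs⟩
  choose n hn hn' using hex
  exact ⟨n, hn, funext fun i => hn' _ i rfl⟩

/-! ### The degrees of the monomials -/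

open scoped Classical in
theorem hasDegree_covariant (q : ℂ) (w : List b.support) (s : b.support) :
    QuasiLaurent.HasDegree q (commExponent b w) (covariant b q w s)
      fun i => if w.get i = s then 1 else 0 := by
  refine Eq.mp (congrArg _ ?_) (QuasiLaurent.HasDegree.list_prod
    ((List.finRange w.length).filter fun j => w.get j = s) (QuasiLaurent.z q (commExponent b w))
    (fun j => Pi.single j (1 : ℤ))
    fun j _ => QuasiLaurent.HasDegree.z j)
  have hfilter : ∀ l : List (Fin w.length),
      ((l.filter fun j => w.get j = s).map fun j => (Pi.single j 1 : Fin w.length → ℤ)).sum =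
        (l.map fun j => if w.get j = s then (Pi.single j 1 : Fin w.length → ℤ) else 0).sum := by
    intro l
    induction l with
    | nil => rfl
    | cons j l ih =>
      rw [List.filter_cons, List.map_cons, List.sum_cons, ← ih]
      by_cases hj : w.get j = s <;> simp only [hj, decide_true, decide_false, if_true, if_false,
        List.map_cons, List.sum_cons, zero_add, Bool.false_eq_true]
  rw [hfilter, ← List.ofFn_eq_map, List.sum_ofFn]
  ext i
  simp only [Finset.sum_apply]
  rw [Finset.sum_eq_single i]
  · by_cases hi : w.get i = s <;> simp only [hi, if_true, if_false, Pi.single_eq_same, Pi.zero_apply]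
  · intro j _ hj
    by_cases hi : w.get j = s <;>
      simp only [hi, if_true, if_false, Pi.single_eq_of_ne hj.symm, Pi.zero_apply]
  · simp

/-- Degrees add whatever the order of the factors, so the numbering `e` affects only the scalar.
Position `i` occurs in exactly one `C_s`, the one of its letter. -/
theorem hasDegree_covariantMonomial {R : ℕ} (e : Fin R ≃ b.support) (q : ℂ) (w : List b.support)
    (n : b.support → ℤ) :
    QuasiLaurent.HasDegree q (commExponent b w) (covariantMonomial b e q w n)
      fun i => n (w.get i) := by
  classical
  rw [covariantMonomial, List.ofFn_eq_map]
  refine Eq.mp (congrArg _ ?_) (QuasiLaurent.HasDegree.list_prod (List.finRange R) _ _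
    fun k _ => (hasDegree_covariant b q w (e k)).zpow (n (e k)))
  rw [← List.ofFn_eq_map, List.sum_ofFn,
    e.sum_comp (fun s => n s • fun i => if w.get i = s then (1 : ℤ) else 0)]
  ext i
  simp [Finset.sum_apply]

end Words

end QuantumTorusCenter

end

/-! ### The center of the word algebra -/

theorem mainTheorem1 {ι V N : Type*} [Fintype ι] [AddCommGroup V] [Module ℝ V]
    [AddCommGroup N] [Module ℝ N] (P : RootPairing ι ℝ V N) [P.IsRootSystem]
    [P.IsCrystallographic] [P.IsReduced] [P.IsIrreducible] (b : P.Base)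
    {R : ℕ} (e : Fin R ≃ b.support)
    (q : ℂ) (hq0 : q ≠ 0) (hq : ∀ k : ℕ, 0 < k → q ^ k ≠ 1)
    (w : List b.support) (hw : QuantumTorusCenter.IsReducedWord b w) :
    (∀ n ∈ QuantumTorusCenter.Exponents b w,
      ((QuantumTorusCenter.covariantMonomial b e q w n :
          QuantumTorusCenter.WordAlgebra b q w) ∈
            Subalgebra.center ℂ (QuantumTorusCenter.WordAlgebra b q w) ↔
        QuantumTorusCenter.restrictedWeight b w n ∈ QuantumTorusCenter.kerOnePlus b w)) ∧
    LinearIndependent ℂ (fun n : QuantumTorusCenter.Exponents b w =>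
      (QuantumTorusCenter.covariantMonomial b e q w n :
        QuantumTorusCenter.WordAlgebra b q w)) ∧
    Subalgebra.toSubmodule (Subalgebra.center ℂ (QuantumTorusCenter.WordAlgebra b q w)) =
      Submodule.span ℂ
        {x | ∃ n ∈ QuantumTorusCenter.Exponents b w,
          QuantumTorusCenter.restrictedWeight b w n ∈ QuantumTorusCenter.kerOnePlus b w ∧
          x = (QuantumTorusCenter.covariantMonomial b e q w n :
            QuantumTorusCenter.WordAlgebra b q w)} := by
  have hdeg := QuantumTorusCenter.hasDegree_covariantMonomial b e q w
  have hcenter : ∀ n, (QuantumTorusCenter.covariantMonomial b e q w n :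
      QuantumTorusCenter.WordAlgebra b q w) ∈
        Subalgebra.center ℂ (QuantumTorusCenter.WordAlgebra b q w) ↔
      QuantumTorusCenter.restrictedWeight b w n ∈ QuantumTorusCenter.kerOnePlus b w := fun n => by
    rw [(hdeg n).mem_center_iff hq0 hq,
      QuantumTorusCenter.sum_mul_skew_eq_zero_iff_restrictedWeight]
  refine ⟨fun n _ => hcenter n, ?_, le_antisymm ?_ ?_⟩
  · refine QuantumTorusCenter.QuasiLaurent.HasDegree.linearIndependent hq0
      (fun n : QuantumTorusCenter.Exponents b w => hdeg n) fun n n' h => Subtype.ext ?_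
    funext s
    -- The degree records `n_s` at any position of the letter `s`; for letters that do not occur,
    -- `n_s = 0` by definition of `Exponents`.
    by_cases hs : s ∈ w
    · obtain ⟨j, rfl⟩ := List.get_of_mem hs
      exact congrFun h j
    · rw [n.2 s hs, n'.2 s hs]
  · choose x hx using fun a => QuantumTorusCenter.QuasiLaurent.HasDegree.exists_unit (q := q)
      (L := QuantumTorusCenter.commExponent b w) a
    rw [QuantumTorusCenter.QuasiLaurent.center_eq_span hq0 hq x hx, Submodule.span_le]
    rintro _ ⟨a, ha, rfl⟩
    obtain ⟨n, hn, rfl⟩ := QuantumTorusCenter.exists_exponents b w a ha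
    -- The chosen monomial and `C^n` have the same degree, hence are proportional.
    obtain ⟨c, hc⟩ := (hdeg n).eq_smul hq0 (hx _)
    simp only [hc]
    exact Submodule.smul_mem _ _ (Submodule.subset_span ⟨n, hn,
      (QuantumTorusCenter.sum_mul_skew_eq_zero_iff_restrictedWeight b w n).1 ha, rfl⟩)
  · rw [Submodule.span_le]
    rintro _ ⟨n, -, hn, rfl⟩
    exact (hcenter n).2 hn
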